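/- Let $(P,\{\cdot,\cdot\})$ be a (Hausdorff, finite-dimensional, smooth) Poisson manifold, that is, $\{\cdot,\cdot\}$ is a Lie bracket on $C^\infty(P)$ which is a derivation in each entry. Let $H\in C^\infty(P)$, let $X_H$ be its Hamiltonian vector field, defined by $X_H[F]=\{F,H\}$ for all $F\in C^\infty(P)$, and let $z_e\in P$ be an equilibrium, $X_H(z_e)=0$. Let $L:T_{z_e}P\to T_{z_e}P$ be the linearization of $X_H$ at $z_e$. Let $(q^1,\dots,q^n,p_1,\dots,p_n,z^1,\dots,z^r)$ be Darboux–Weinstein coordinates on an open set $U\ni z_e$: a smooth chart that sends $z_e$ to $0$ such that on $U$ $$\{q^i,q^j\}=\{p_i,p_j\}=\{q^i,z^k\}=\{p_i,z^k\}=0,\qquad \{q^i,p_j\}=\delta^i_j,$$ and such that each $\{z^k,z^l\}$ is a function of $z^1,\dots,z^r$ only and vanishes at $z_e$. In the coordinates $(x,z)$ with $x=(q,p)$, the matrix of $L$ has the block form $$L=\begin{pmatrix}\mathcal S&\mathcal Q\\0&\mathcal P\end{pmatrix},$$ where $\mathcal S$ is $2n\times 2n$ and $\mathcal P$ is $r\times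 r$. One says that $L$ exhibits a *coupled passing* if there are $\mu\in\mathbb C$ and an eigenvector $v\in\mathbb C^r\setminus\{0\}$ with $\mathcal P v=\mu v$ such that $\mu$ is also an eigenvalue of $\mathcal S$ and the preimage $$(\mathcal S-\mu I)^{-1}\mathcal Q v:=\{w\in\mathbb C^{2n} : (\mathcal S-\mu I)w=\mathcal Q v\}$$ is empty. **Proposition.** If $L$ exhibits a coupled passing, then $z_e$ is linearly unstable: the origin is an unstable (that is, not Lyapunov stable) equilibrium of the linear dynamical system $\dot v=Lv$ on $T_{z_e}P$. -/

import Mathlib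

open scoped Manifold ContDiff Topology

noncomputable section

namespace PoissonDynamics

/-- A parameter integral over `[0, 1]` of a smooth function is smooth. -/
theorem contDiff_paramIntegral.{u} {E : Type u} [NormedAddCommGroup E] [NormedSpace ℝ E]
    [FiniteDimensional ℝ E] (n : ℕ) : ∀ {F : Type u} [NormedAddCommGroup F] [NormedSpace ℝ F]
    [CompleteSpace F] (K : E → ℝ → F), ContDiff ℝ ∞ (fun p : E × ℝ => K p.1 p.2) →
      ContDiff ℝ n (fun y => ∫ t in (0:ℝ)..1, K y t) := by
  induction n with
  | zero =>
    intro F _ _ _ K hK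
    have : Continuous (Function.uncurry K) := hK.continuous
    exact contDiff_zero.2 (intervalIntegral.continuous_parametric_intervalIntegral_of_continuous' this 0 1)
  | succ n ih =>
    intro F _ _ _ K hK
    let K' : E → ℝ → (E →L[ℝ] F) := fun y t => (fderiv ℝ (fun p : E × ℝ => K p.1 p.2) (y, t)).comp
      (ContinuousLinearMap.inl ℝ E ℝ)
    have hK' : ContDiff ℝ ∞ (fun p : E × ℝ => K' p.1 p.2) :=
      (hK.fderiv_right (m := ∞) (by simp)).clm_comp contDiff_const
    have hd : ∀ y, HasFDerivAt (fun y => ∫ t in (0:ℝ)..1, K y t) (∫ t in (0:ℝ)..1, K' y t) y := by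
      intro y
      have hc : Continuous (Function.uncurry K') := hK'.continuous
      obtain ⟨C, hC⟩ := ((isCompact_closedBall y 1).prod (isCompact_Icc (a := (0:ℝ)) (b := 1))).exists_bound_of_continuousOn
        hc.continuousOn
      refine intervalIntegral.hasFDerivAt_integral_of_dominated_of_fderiv_le (bound := fun _ => C)
        (Metric.closedBall_mem_nhds y one_pos) ?_ ?_ ?_ ?_ ?_ ?_
      · refine Filter.Eventually.of_forall fun x => ?_
        exact (hK.continuous.comp (by fun_prop : Continuous fun t : ℝ => (x, t))).aestronglyMeasurable
      · exact (hK.continuous.comp (by fun_prop : Continuous fun t : ℝ => (y, t))).intervalIntegrable _ _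
      · exact (hK'.continuous.comp (by fun_prop : Continuous fun t : ℝ => (y, t))).aestronglyMeasurable
      · refine Filter.Eventually.of_forall fun t ht x hx => hC (x, t) ⟨hx, ?_⟩
        rw [Set.uIoc_of_le zero_le_one] at ht
        exact ⟨ht.1.le, ht.2⟩
      · simp
      · refine Filter.Eventually.of_forall fun t ht x hx => ?_
        have h1 := (hK.differentiable (by simp) (x, t)).hasFDerivAt
        exact HasFDerivAt.comp (g := fun p : E × ℝ => K p.1 p.2) (f := fun e : E => (e, t)) x h1
          (hasFDerivAt_prodMk_left x t)
    rw [show ((n + 1 : ℕ) : WithTop ℕ∞) = (n : WithTop ℕ∞) + 1 by norm_cast,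
      contDiff_succ_iff_fderiv]
    refine ⟨fun y => (hd y).differentiableAt, by simp, ?_⟩
    rw [show fderiv ℝ (fun y => ∫ t in (0:ℝ)..1, K y t) = fun y => ∫ t in (0:ℝ)..1, K' y t from
      funext fun y => (hd y).fderiv]
    exact ih K' hK'

/-- Hadamard's lemma. -/
theorem exists_hadamard_factor {E : Type*} [NormedAddCommGroup E] [NormedSpace ℝ E]
    [FiniteDimensional ℝ E] (g : E → ℝ) (hg : ContDiff ℝ ∞ g) (a : E) :
    ∃ h : E → (E →L[ℝ] ℝ), ContDiff ℝ ∞ h ∧ h a = fderiv ℝ g a ∧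
      ∀ y, g y = g a + h y (y - a) := by
  have hK : ContDiff ℝ ∞ (fun p : E × ℝ => fderiv ℝ g (a + p.2 • (p.1 - a))) :=
    (hg.fderiv_right (m := ∞) (by simp)).comp (by fun_prop)
  refine ⟨fun y => ∫ t in (0:ℝ)..1, fderiv ℝ g (a + t • (y - a)), ?_, by simp, fun y => ?_⟩
  · exact contDiff_infty.2 fun n => contDiff_paramIntegral n _ hK
  · have hc : Continuous fun t : ℝ => fderiv ℝ g (a + t • (y - a)) :=
      hK.continuous.comp (by fun_prop : Continuous fun t : ℝ => (y, t))
    rw [ContinuousLinearMap.intervalIntegral_apply (hc.intervalIntegrable _ _)]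
    have := intervalIntegral.integral_eq_sub_of_hasDerivAt (a := 0) (b := 1)
      (f := fun t : ℝ => g (a + t • (y - a)))
      (f' := fun t => fderiv ℝ g (a + t • (y - a)) (y - a)) (fun t _ => ?_)
      ((hc.clm_apply continuous_const).intervalIntegrable _ _)
    · rw [this]; simp
    · have h1 := (hg.differentiable (by simp) (a + t • (y - a))).hasFDerivAt
      have h2 : HasDerivAt (fun t : ℝ => a + t • (y - a)) (y - a) t := by
        simpa using ((hasDerivAt_id t).smul_const (y - a)).const_add a
      exact h1.comp_hasDerivAt t h2

/-- A derivation at `z` of the algebra of smooth functions is given by a tangent vector. -/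
theorem exists_tangentVector_of_derivation {E : Type*} [NormedAddCommGroup E] [NormedSpace ℝ E] [FiniteDimensional ℝ E]
    {M : Type*} [TopologicalSpace M] [T2Space M] [ChartedSpace E M] [IsManifold 𝓘(ℝ, E) ∞ M]
    (z : M) (D : C^∞⟮𝓘(ℝ, E), M; ℝ⟯ →ₗ[ℝ] ℝ)
    (hD : ∀ f g, D (f * g) = f z * D g + g z * D f) :
    ∃ v : TangentSpace 𝓘(ℝ, E) z, ∀ f : C^∞⟮𝓘(ℝ, E), M; ℝ⟯,
      mfderiv 𝓘(ℝ, E) 𝓘(ℝ, ℝ) f z v = D f := by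
  set x := extChartAt 𝓘(ℝ, E) z with hx
  set a := x z with ha
  have hT : x.target ∈ 𝓝 a := by
    exact extChartAt_target_mem_nhds (I := 𝓘(ℝ, E)) z
  obtain ⟨ε, hε, hεT⟩ := Metric.nhds_basis_closedBall.mem_iff.1 hT
  let ψ : ContDiffBump a := ⟨ε / 2, ε, by positivity, by linarith⟩
  have hs : x.source ∈ 𝓝 z := extChartAt_source_mem_nhds z
  have hN : x.source ∩ x ⁻¹' (Metric.ball a (ε / 2)) ∈ 𝓝 z :=
    Filter.inter_mem hs ((continuousAt_extChartAt z).preimage_mem_nhds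
      (Metric.ball_mem_nhds _ (by positivity)))
  obtain ⟨χ, -, hχ⟩ := (SmoothBumpFunction.nhds_basis_support (I := 𝓘(ℝ, E)) hN).mem_iff.1 hN
  have hχz : χ z = 1 := χ.eq_one
  -- extension of coordinate functions
  have hsm : ∀ u : E → ℝ, ContDiff ℝ ∞ u → ContMDiff 𝓘(ℝ, E) 𝓘(ℝ, ℝ) ∞ (fun w => χ w * u (x w)) := by
    intro u hu
    have := χ.contMDiff_smul (g := fun w => u (x w)) (hu.contMDiff.comp_contMDiffOn
      (contMDiffOn_extChartAt (I := 𝓘(ℝ, E)) (x := z) (n := ∞)))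
    simpa using this
  let ext : (u : E → ℝ) → ContDiff ℝ ∞ u → C^∞⟮𝓘(ℝ, E), M; ℝ⟯ := fun u hu => ⟨_, hsm u hu⟩
  have hone : D 1 = 0 := by
    have := hD 1 1
    simp at this
    exact this
  have hconst : ∀ c : ℝ, D (algebraMap ℝ _ c) = 0 := fun c => by
    rw [Algebra.algebraMap_eq_smul_one, map_smul, hone, smul_zero]
  let b := Module.finBasis ℝ E
  let l : Fin (Module.finrank ℝ E) → (E →L[ℝ] ℝ) := fun i => LinearMap.toContinuousLinearMap (b.coord i)
  have hl : ∀ i, ContDiff ℝ ∞ (fun y : E => l i (y - a)) := fun i => by fun_prop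
  let v : E := ∑ i, D (ext _ (hl i)) • b i
  refine ⟨v, fun f => ?_⟩
  -- the local representative of `f`
  have hg : ContDiff ℝ ∞ (fun y => ψ y * f (x.symm y)) := by
    rw [contDiff_iff_contDiffAt]
    intro y
    by_cases hy : y ∈ tsupport ψ
    · have hyT : y ∈ x.target := by
        apply hεT
        rw [ψ.tsupport_eq] at hy
        exact hy
      have h1 : ContMDiffAt 𝓘(ℝ, E) 𝓘(ℝ, ℝ) ∞ (fun y => f (x.symm y)) y :=
        (f.contMDiff (x.symm y)).comp y
          ((contMDiffOn_extChartAt_symm (I := 𝓘(ℝ, E)) (n := ∞) z).contMDiffAt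
            ((isOpen_extChartAt_target z).mem_nhds hyT))
      exact ψ.contDiffAt.mul h1.contDiffAt
    · have : (fun y => ψ y * f (x.symm y)) =ᶠ[𝓝 y] fun _ => 0 := by
        filter_upwards [(isClosed_tsupport ψ).isOpen_compl.mem_nhds hy] with w hw
        rw [image_eq_zero_of_notMem_tsupport hw, zero_mul]
      exact contDiffAt_const.congr_of_eventuallyEq this
  obtain ⟨h, hh, hha, hhy⟩ := exists_hadamard_factor _ hg a
  have hga : (fun y => ψ y * f (x.symm y)) a = f z := by
    have h1 : ψ a = 1 := ψ.one_of_mem_closedBall (Metric.mem_closedBall_self ψ.rIn_pos.le)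
    have h2 : x.symm a = z := extChartAt_to_inv z
    simp only [h1, h2, one_mul]
  have hb : ∀ i, ContDiff ℝ ∞ (fun y : E => h y (b i)) := fun i => hh.clm_apply contDiff_const
  let X : C^∞⟮𝓘(ℝ, E), M; ℝ⟯ := ⟨χ, χ.contMDiff⟩
  have key : X * X * (f - algebraMap ℝ _ (f z)) = ∑ i, ext _ (hb i) * ext _ (hl i) := by
    ext w
    have hR : (∑ i, ext _ (hb i) * ext _ (hl i)) w
        = ∑ i, (χ w * h (x w) (b i)) * (χ w * l i (x w - a)) := by
      have h1 := map_sum (ContMDiffMap.coeFnAddMonoidHom (I := 𝓘(ℝ, E)) (N := M) (I' := 𝓘(ℝ, ℝ))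
        (G := ℝ) (n := ∞)) (fun i => ext _ (hb i) * ext _ (hl i)) Finset.univ
      have h2 := congrFun h1 w
      rw [Finset.sum_apply] at h2
      exact h2
    have hL : (X * X * (f - algebraMap ℝ _ (f z))) w = χ w * χ w * (f w - f z) := rfl
    rw [hL, hR]
    by_cases hw : w ∈ Function.support χ
    · obtain ⟨hws, hwb⟩ := hχ hw
      have h1 : (fun y => ψ y * f (x.symm y)) (x w)
          = (fun y => ψ y * f (x.symm y)) a + h (x w) (x w - a) := hhy (x w)
      have h2 : ψ (x w) = 1 := ψ.one_of_mem_closedBall (Metric.ball_subset_closedBall hwb)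
      rw [hga] at h1
      simp only [h2, one_mul, x.left_inv hws] at h1
      have h3 : h (x w) (x w - a) = ∑ i, l i (x w - a) * h (x w) (b i) := by
        conv_lhs => rw [← b.sum_repr (x w - a)]
        simp [l]
      rw [h1, h3, add_sub_cancel_left, Finset.mul_sum]
      exact Finset.sum_congr rfl fun i _ => by ring
    · rw [Function.notMem_support] at hw
      simp [hw]
  have hD1 := congrArg D key
  rw [map_sum] at hD1
  have e1 : D (X * X * (f - algebraMap ℝ _ (f z))) = D f := by
    rw [hD, map_sub, hconst, sub_zero]
    have : (X * X) z = 1 := by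
      change χ z * χ z = 1
      rw [hχz, one_mul]
    have h2 : (f - algebraMap ℝ _ (f z)) z = 0 := by
      change f z - f z = 0
      simp
    rw [this, h2]; simp
  have e2 : ∀ i, D (ext _ (hb i) * ext _ (hl i)) = h a (b i) * D (ext _ (hl i)) := by
    intro i
    rw [hD]
    have h1 : (ext _ (hb i)) z = h a (b i) := by
      change χ z * h a (b i) = _
      rw [hχz, one_mul]
    have h2 : (ext _ (hl i)) z = 0 := by
      change χ z * l i (a - a) = 0
      simp
    rw [h1, h2]; simp
  rw [e1] at hD1
  rw [hD1]
  have hm : mfderiv 𝓘(ℝ, E) 𝓘(ℝ, ℝ) f z = fderiv ℝ (fun y => ψ y * f (x.symm y)) a := by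
    rw [(f.contMDiff.mdifferentiable (by simp) z).mfderiv]
    simp only [modelWithCornersSelf_coe, Set.range_id, fderivWithin_univ]
    apply Filter.EventuallyEq.fderiv_eq
    filter_upwards [ψ.eventuallyEq_one] with y hy
    have hy' : ψ y = 1 := hy
    simp only [hy', one_mul]
    rfl
  rw [hm, ← hha]
  change h a v = _
  simp only [v, map_sum, map_smul, smul_eq_mul]
  exact Finset.sum_congr rfl fun i _ => by rw [e2]; ring

section Poisson

variable (E : Type*) [NormedAddCommGroup E] [NormedSpace ℝ E]
  (M : Type*) [TopologicalSpace M] [ChartedSpace E M]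

/-- A Poisson structure on the manifold `M`: a bilinear bracket on the smooth functions that is a
Lie bracket and a derivation in each entry (the second entry by skew-symmetry). -/
structure PoissonStructure where
  bracket : C^∞⟮𝓘(ℝ, E), M; ℝ⟯ →ₗ[ℝ] C^∞⟮𝓘(ℝ, E), M; ℝ⟯ →ₗ[ℝ] C^∞⟮𝓘(ℝ, E), M; ℝ⟯
  skew : ∀ F G, bracket F G = -bracket G F
  jacobi : ∀ F G K,
    bracket F (bracket G K) + bracket G (bracket K F) + bracket K (bracket F G) = 0
  leibniz : ∀ F G K, bracket (F * G) K = F * bracket G K + G * bracket F K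

end Poisson

variable {E : Type*} [NormedAddCommGroup E] [NormedSpace ℝ E]
  {M : Type*} [TopologicalSpace M] [ChartedSpace E M]

theorem PoissonStructure.exists_hamiltonianVector [FiniteDimensional ℝ E] [T2Space M]
    [IsManifold 𝓘(ℝ, E) ∞ M] (B : PoissonStructure E M) (H : C^∞⟮𝓘(ℝ, E), M; ℝ⟯) (z : M) :
    ∃ v : TangentSpace 𝓘(ℝ, E) z, ∀ F : C^∞⟮𝓘(ℝ, E), M; ℝ⟯,
      mfderiv 𝓘(ℝ, E) 𝓘(ℝ, ℝ) F z v = B.bracket F H z := by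
  refine exists_tangentVector_of_derivation z
    { toFun := fun F => B.bracket F H z
      map_add' := fun F G => ?_
      map_smul' := fun c F => ?_ } fun F G => ?_
  · rw [map_add]; rfl
  · rw [map_smul]; rfl
  · change B.bracket (F * G) H z = _
    rw [B.leibniz]; rfl

/-- The Hamiltonian vector field `X_H`: `X_H(z)` is the tangent vector with
`X_H[F](z) = {F, H}(z)` for every smooth `F`. -/
def PoissonStructure.hamiltonianVectorField [FiniteDimensional ℝ E] [T2Space M]
    [IsManifold 𝓘(ℝ, E) ∞ M] (B : PoissonStructure E M) (H : C^∞⟮𝓘(ℝ, E), M; ℝ⟯) (z : M) :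
    TangentSpace 𝓘(ℝ, E) z :=
  Classical.choose (B.exists_hamiltonianVector H z)

/-- The defining property of the Hamiltonian vector field. -/
theorem PoissonStructure.mfderiv_hamiltonianVectorField [FiniteDimensional ℝ E] [T2Space M]
    [IsManifold 𝓘(ℝ, E) ∞ M] (B : PoissonStructure E M) (F H : C^∞⟮𝓘(ℝ, E), M; ℝ⟯) (z : M) :
    mfderiv 𝓘(ℝ, E) 𝓘(ℝ, ℝ) F z (B.hamiltonianVectorField H z) = B.bracket F H z :=
  Classical.choose_spec (B.exists_hamiltonianVector H z) F

/-- The bracket, at the point `w`, of two functions that are only defined and smooth near `w`: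
it equals `c` when `{F, G}(w) = c` for global smooth functions `F`, `G` that agree with `f`, `g`
near `w`. (Such extensions exist, and the value does not depend on them.) -/
def PoissonStructure.HasLocalBracket (B : PoissonStructure E M) (f g : M → ℝ) (w : M) (c : ℝ) :
    Prop :=
  ∃ F G : C^∞⟮𝓘(ℝ, E), M; ℝ⟯, F =ᶠ[𝓝 w] f ∧ G =ᶠ[𝓝 w] g ∧ B.bracket F G w = c

/-- Indices of the coordinates `(q, p, z)`, with `q, p ∈ ℝ^n` and `z ∈ ℝ^r`. The coordinates
`x = (q, p)` form the left summand. -/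
abbrev DWIndex (n r : ℕ) : Type := (Fin n ⊕ Fin n) ⊕ Fin r

/-- Darboux-Weinstein charts `φ = (q, p, z)` of the Poisson manifold around the point `z₀`. -/
structure PoissonStructure.IsDarbouxWeinsteinChart (B : PoissonStructure E M) {n r : ℕ}
    (φ : OpenPartialHomeomorph M (DWIndex n r → ℝ)) (z₀ : M) : Prop where
  mem_source : z₀ ∈ φ.source
  map_point : φ z₀ = 0
  contMDiffOn : ContMDiffOn 𝓘(ℝ, E) 𝓘(ℝ, DWIndex n r → ℝ) ∞ φ φ.source
  contMDiffOn_symm : ContMDiffOn 𝓘(ℝ, DWIndex n r → ℝ) 𝓘(ℝ, E) ∞ φ.symm φ.target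
  bracket_qq : ∀ w ∈ φ.source, ∀ i j : Fin n,
    B.HasLocalBracket (fun y => φ y (.inl (.inl i))) (fun y => φ y (.inl (.inl j))) w 0
  bracket_pp : ∀ w ∈ φ.source, ∀ i j : Fin n,
    B.HasLocalBracket (fun y => φ y (.inl (.inr i))) (fun y => φ y (.inl (.inr j))) w 0
  bracket_qp : ∀ w ∈ φ.source, ∀ i j : Fin n,
    B.HasLocalBracket (fun y => φ y (.inl (.inl i))) (fun y => φ y (.inl (.inr j))) w
      (if i = j then 1 else 0)
  bracket_qz : ∀ w ∈ φ.source, ∀ (i : Fin n) (k : Fin r),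
    B.HasLocalBracket (fun y => φ y (.inl (.inl i))) (fun y => φ y (.inr k)) w 0
  bracket_pz : ∀ w ∈ φ.source, ∀ (i : Fin n) (k : Fin r),
    B.HasLocalBracket (fun y => φ y (.inl (.inr i))) (fun y => φ y (.inr k)) w 0
  /-- The brackets of the transverse coordinates depend on these coordinates only, and vanish at
  the base point. -/
  bracket_zz : ∃ R : (Fin r → ℝ) → Matrix (Fin r) (Fin r) ℝ, R 0 = 0 ∧
    ∀ w ∈ φ.source, ∀ k l : Fin r,
      B.HasLocalBracket (fun y => φ y (.inr k)) (fun y => φ y (.inr l)) w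
        (R (fun m => φ w (.inr m)) k l)

/-- The linearization at a zero `z₀` of the vector field `X`, as an endomorphism of the tangent
space at `z₀`: the derivative at `z₀` of `X` read in the trivialization of the tangent bundle
given by the preferred chart at `z₀` (which is the identity on the fibre over `z₀`). -/
def linearization [IsManifold 𝓘(ℝ, E) ∞ M] (X : (w : M) → TangentSpace 𝓘(ℝ, E) w) (z₀ : M) :
    TangentSpace 𝓘(ℝ, E) z₀ →L[ℝ] TangentSpace 𝓘(ℝ, E) z₀ :=
  haveI : IsManifold 𝓘(ℝ, E) 1 M := IsManifold.of_le (n := ∞) (by simp)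
  mfderiv 𝓘(ℝ, E) 𝓘(ℝ, E)
    (fun w => (trivializationAt E (TangentSpace 𝓘(ℝ, E)) z₀ ⟨w, X w⟩).2) z₀

/-- The matrix of an endomorphism `L` of the tangent space at `z₀` in the basis of coordinate
vectors of the chart `φ`. -/
def matrixInChart {ι : Type*} [Fintype ι] [DecidableEq ι] (φ : OpenPartialHomeomorph M (ι → ℝ))
    (z₀ : M) (L : TangentSpace 𝓘(ℝ, E) z₀ →L[ℝ] TangentSpace 𝓘(ℝ, E) z₀) : Matrix ι ι ℝ :=
  let dφ : TangentSpace 𝓘(ℝ, E) z₀ →L[ℝ] (ι → ℝ) := mfderiv 𝓘(ℝ, E) 𝓘(ℝ, ι → ℝ) φ z₀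
  LinearMap.toMatrix' (dφ ∘L L ∘L dφ.inverse).toLinearMap

/-- A coupled passing of the real block matrix `(S Q; 0 P)`: a complex eigenvalue `μ` of `P`, with
eigenvector `v`, is also an eigenvalue of `S`, and the preimage `(S - μ I)⁻¹ Q v` is empty. -/
def CoupledPassing {a b : Type*} [Fintype a] [DecidableEq a] [Fintype b] [DecidableEq b]
    (S : Matrix a a ℝ) (Q : Matrix a b ℝ) (P : Matrix b b ℝ) : Prop :=
  ∃ (μ : ℂ) (v : b → ℂ),
    Module.End.HasEigenvector (Matrix.toLin' (P.map Complex.ofReal)) μ v ∧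
    Module.End.HasEigenvalue (Matrix.toLin' (S.map Complex.ofReal)) μ ∧
    {w : a → ℂ | (S.map Complex.ofReal - μ • 1).mulVec w = (Q.map Complex.ofReal).mulVec v} = ∅

/-- The linearization of `X` at `z₀`, written in block form with respect to the coordinates
`(x, z)` of the chart `φ`, exhibits a coupled passing. -/
def ExhibitsCoupledPassing [IsManifold 𝓘(ℝ, E) ∞ M] (X : (w : M) → TangentSpace 𝓘(ℝ, E) w)
    (z₀ : M) {n r : ℕ} (φ : OpenPartialHomeomorph M (DWIndex n r → ℝ)) : Prop :=
  let A := matrixInChart φ z₀ (linearization X z₀)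
  CoupledPassing A.toBlocks₁₁ A.toBlocks₁₂ A.toBlocks₂₂

/-- Lyapunov stability of the origin for the linear dynamical system `γ' = L γ`. -/
def IsStableLinearSystem {T : Type*} [AddCommGroup T] [Module ℝ T] [TopologicalSpace T]
    [ContinuousSMul ℝ T] (L : T →L[ℝ] T) : Prop :=
  ∀ U : Set T, IsOpen U → (0 : T) ∈ U → ∃ V : Set T, IsOpen V ∧ (0 : T) ∈ V ∧ V ⊆ U ∧
    ∀ γ : ℝ → T, (∀ t, HasDerivAt γ (L (γ t)) t) → γ 0 ∈ V → ∀ t > 0, γ t ∈ U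

/-- The zero `z₀` of the vector field `X` is linearly unstable: the origin is an unstable (that is,
not Lyapunov stable) equilibrium of the linear system defined by the linearization. -/
def IsLinearlyUnstable [IsManifold 𝓘(ℝ, E) ∞ M] (X : (w : M) → TangentSpace 𝓘(ℝ, E) w)
    (z₀ : M) : Prop :=
  ¬ IsStableLinearSystem (linearization X z₀)

end PoissonDynamics

end

open PoissonDynamics

/-! A stable linear system has all its forward trajectories bounded, because small multiples of any
initial value stay in the unit ball. A coupled passing always produces an unbounded one, and the
sign of `μ.re` decides which.

If `0 ≤ μ.re`, the passing is a resonance. As `Q v` is not in the range of `S - μ`, some functional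
`ℓ` kills that range but not `Q v`. Along the trajectory from `(0, v)` one has `z = exp (μ t) v`,
and `exp (-μ t) ℓ(x)` has constant derivative `ℓ (Q v)`. So `ℓ(x) = t exp (μ t) ℓ (Q v)`, which is
unbounded (`HasBoundedTrajectories.exists_mulVec_eq`).

If `μ.re < 0`, the block `S = -J K` with `K` symmetric has a spectrum symmetric about the origin
(`charpoly_neg_J_mul_eq`). So `-μ` is an eigenvalue too, and its eigenvector, padded by zero, grows
exponentially (`HasBoundedTrajectories.re_nonpos`).

The geometric half is `linearization_blocks`: `K` is the Hessian of `H` in the `x` variables, and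
the lower left block vanishes because the `z` components of the field are zero along `z = 0`. -/

namespace PoissonDynamics

/-! ### Stability, bounded trajectories and the resonant secular term -/

/-- Every trajectory of a stable linear system is bounded in forward time. -/
theorem IsStableLinearSystem.exists_bounded_trajectory {T : Type*} [NormedAddCommGroup T]
    [NormedSpace ℝ T] [CompleteSpace T] {L : T →L[ℝ] T} (hL : IsStableLinearSystem L) (x₀ : T) :
    ∃ (γ : ℝ → T) (C : ℝ), γ 0 = x₀ ∧ (∀ t, HasDerivAt γ (L (γ t)) t) ∧ ∀ t > 0, ‖γ t‖ ≤ C := by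
  obtain ⟨V, hVo, hV0, -, hV⟩ := hL (Metric.ball 0 1) Metric.isOpen_ball (by simp)
  have hγ : ∀ (y : T) (t : ℝ), HasDerivAt (fun s : ℝ => NormedSpace.exp (s • L) y)
      (L (NormedSpace.exp (t • L) y)) t := fun y t => by
    simpa using (hasDerivAt_exp_smul_const' (𝕂 := ℝ) L t).clm_apply (hasDerivAt_const t y)
  have hc : Filter.Tendsto (fun c : ℝ => c • x₀) (𝓝[>] 0) (𝓝 0) := by
    have : Continuous fun c : ℝ => c • x₀ := by fun_prop
    simpa using (this.tendsto 0).mono_left nhdsWithin_le_nhds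
  obtain ⟨c, hcV, hc0⟩ :=
    ((hc.eventually (hVo.mem_nhds hV0)).and self_mem_nhdsWithin).exists
  have hc0 : 0 < c := hc0
  -- The trajectory from `c • x₀` stays in the unit ball and is `c` times the one from `x₀`, hence
  -- the bound `c⁻¹`.
  refine ⟨fun s => NormedSpace.exp (s • L) x₀, c⁻¹, by simp, hγ x₀, fun t ht => ?_⟩
  have h := hV (fun s => NormedSpace.exp (s • L) (c • x₀)) (hγ _) (by simp only [zero_smul, NormedSpace.exp_zero]; exact hcV) t ht
  simp only [mem_ball_zero_iff, map_smul, norm_smul, Real.norm_eq_abs, abs_of_pos hc0] at h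
  rw [← one_div, le_div_iff₀ hc0]
  linarith

/-- Every initial value of the complex linear system `X' = A X` has a trajectory that is bounded
in forward time. -/
def HasBoundedTrajectories {ι : Type*} [Fintype ι] (A : Matrix ι ι ℂ) : Prop :=
  ∀ x₀ : ι → ℂ, ∃ (X : ℝ → ι → ℂ) (C : ℝ), X 0 = x₀ ∧ (∀ t, HasDerivAt X (A.mulVec (X t)) t) ∧
    ∀ t > 0, ‖X t‖ ≤ C

/-- Passes to coordinates and complexifies, so that complex eigenvectors may serve as initial
values. As `A` is real, a complex trajectory is assembled from two real ones. -/
theorem IsStableLinearSystem.hasBoundedTrajectories {T : Type*} [NormedAddCommGroup T]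
    [NormedSpace ℝ T] [CompleteSpace T] {L : T →L[ℝ] T} (hL : IsStableLinearSystem L)
    {ι : Type*} [Fintype ι] {A : Matrix ι ι ℝ} (e : T →L[ℝ] (ι → ℝ)) (e' : (ι → ℝ) →L[ℝ] T)
    (hee' : ∀ y, e (e' y) = y) (he : ∀ v, e (L v) = A.mulVec (e v)) :
    HasBoundedTrajectories (A.map Complex.ofReal) := by
  have real : ∀ y₀ : ι → ℝ, ∃ (Y : ℝ → ι → ℝ) (C : ℝ), Y 0 = y₀ ∧
      (∀ t, HasDerivAt Y (A.mulVec (Y t)) t) ∧ ∀ t > 0, ‖Y t‖ ≤ C := by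
    intro y₀
    obtain ⟨γ, C, h0, hd, hC⟩ := hL.exists_bounded_trajectory (e' y₀)
    refine ⟨fun t => e (γ t), ‖e‖ * C, by simp [h0, hee'], fun t => ?_, fun t ht => ?_⟩
    · rw [← he]
      exact e.hasFDerivAt.comp_hasDerivAt t (hd t)
    · exact (e.le_opNorm _).trans (by gcongr; exact hC t ht)
  intro x₀
  obtain ⟨Y, C, hY0, hY, hYC⟩ := real fun i => (x₀ i).re
  obtain ⟨Z, D, hZ0, hZ, hZD⟩ := real fun i => (x₀ i).im
  refine ⟨fun t i => Y t i + Z t i * Complex.I, C + D, ?_, fun t => ?_, fun t ht => ?_⟩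
  · ext i
    simp [hY0, hZ0, Complex.re_add_im]
  · rw [hasDerivAt_pi]
    intro i
    have h1 := ((hasDerivAt_pi.1 (hY t)) i).ofReal_comp
    have h2 := (((hasDerivAt_pi.1 (hZ t)) i).ofReal_comp).mul_const Complex.I
    refine (h1.add h2).congr_deriv ?_
    simp only [Matrix.mulVec, dotProduct, Matrix.map_apply, Complex.ofReal_sum,
      Complex.ofReal_mul, mul_add, Finset.sum_add_distrib, Finset.sum_mul, mul_assoc]
  · have hC0 : 0 ≤ C + D :=
      add_nonneg ((norm_nonneg _).trans (hYC t ht)) ((norm_nonneg _).trans (hZD t ht))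
    refine (pi_norm_le_iff_of_nonneg hC0).2 fun i => (norm_add_le _ _).trans ?_
    have h1 := (norm_le_pi_norm (Y t) i).trans (hYC t ht)
    have h2 := (norm_le_pi_norm (Z t) i).trans (hZD t ht)
    simp only [norm_mul, Complex.norm_I, mul_one, Complex.norm_real]
    exact add_le_add h1 h2

/-- The trajectory of a linear system that starts at an eigenvector. -/
theorem eq_exp_smul_of_hasDerivAt_mulVec {ι : Type*} [Fintype ι] {A : Matrix ι ι ℂ}
    {X : ℝ → ι → ℂ} (hX : ∀ t, HasDerivAt X (A.mulVec (X t)) t) {ν : ℂ}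
    (hν : A.mulVec (X 0) = ν • X 0) (t : ℝ) : X t = Complex.exp (ν * t) • X 0 := by
  classical
  have hY : ∀ s : ℝ, HasDerivAt (fun s : ℝ => Complex.exp (ν * s) • X 0)
      (A.mulVec (Complex.exp (ν * s) • X 0)) s := by
    intro s
    have h1 : HasDerivAt (fun s : ℝ => Complex.exp (ν * s)) (Complex.exp (ν * s) * ν) s := by
      have := ((Complex.ofRealCLM.hasDerivAt (x := s)).const_mul ν).cexp
      simpa using this
    refine (h1.smul_const (X 0)).congr_deriv ?_
    rw [Matrix.mulVec_smul, hν, smul_smul]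
  let l : (ι → ℂ) →L[ℂ] (ι → ℂ) := LinearMap.toContinuousLinearMap (Matrix.toLin' A)
  have := ODE_solution_unique_univ (v := fun _ x => A.mulVec x) (s := fun _ => Set.univ)
    (K := ‖l‖₊) (t₀ := 0) (fun _ => l.lipschitz.lipschitzOnWith)
    (fun s => ⟨hX s, trivial⟩) (fun s => ⟨hY s, trivial⟩) (by simp)
  exact congrFun this t

/-- The trajectory from `v` is `exp (ν t) v`, of norm `exp (ν.re t) ‖v‖`. -/
theorem HasBoundedTrajectories.re_nonpos {ι : Type*} [Fintype ι] {A : Matrix ι ι ℂ}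
    (hA : HasBoundedTrajectories A) {ν : ℂ} {v : ι → ℂ} (hv : v ≠ 0) (h : A.mulVec v = ν • v) :
    ν.re ≤ 0 := by
  by_contra! hν
  obtain ⟨X, C, rfl, hX, hC⟩ := hA v
  have hn : 0 < ‖X 0‖ := norm_pos_iff.2 hv
  have key : ∀ t > 0, Real.exp (ν.re * t) * ‖X 0‖ ≤ C := fun t ht => by
    have := hC t ht
    rw [eq_exp_smul_of_hasDerivAt_mulVec hX h t, norm_smul, Complex.norm_exp] at this
    simpa using this
  have hlim : Filter.Tendsto (fun t : ℝ => Real.exp (ν.re * t) * ‖X 0‖) Filter.atTop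
      Filter.atTop :=
    (Real.tendsto_exp_atTop.comp (Filter.tendsto_id.const_mul_atTop hν)).atTop_mul_const hn
  obtain ⟨t, ht, ht'⟩ :=
    ((Filter.eventually_gt_atTop (0 : ℝ)).and (hlim.eventually_gt_atTop C)).exists
  exact absurd (key t ht) (not_le.2 ht')

/-- If the block triangular system is bounded in forward time, then an eigenvector `v` of the
lower block, with eigenvalue in the closed right half-plane, has a preimage of `Q v`. -/
theorem HasBoundedTrajectories.exists_mulVec_eq {a b : Type*} [Fintype a] [DecidableEq a]
    [Fintype b] {S : Matrix a a ℂ} {Q : Matrix a b ℂ} {P : Matrix b b ℂ}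
    (hA : HasBoundedTrajectories (Matrix.fromBlocks S Q 0 P)) {μ : ℂ} {v : b → ℂ}
    (hv : P.mulVec v = μ • v) (hμ : 0 ≤ μ.re) :
    ∃ w, (S - μ • 1).mulVec w = Q.mulVec v := by
  by_contra! hw
  have hmem : Q.mulVec v ∉ LinearMap.range (Matrix.mulVecLin (S - μ • 1)) := by
    rintro ⟨w, hw'⟩
    exact hw w hw'
  -- `ℓ` is a left eigenvector of `S` for `μ`, or zero on nothing less than the range of `S - μ`,
  -- with `ℓ (Q v) ≠ 0`.
  obtain ⟨ℓ, hℓ, hle⟩ := Submodule.exists_le_ker_of_notMem hmem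
  have hS : ∀ w, ℓ (S.mulVec w) = μ * ℓ w := by
    intro w
    have h : ℓ ((S - μ • 1).mulVec w) = 0 := hle ⟨w, rfl⟩
    rw [Matrix.sub_mulVec, Matrix.smul_mulVec, Matrix.one_mulVec, map_sub, map_smul, sub_eq_zero]
      at h
    exact h
  obtain ⟨X, C, h0, hX, hC⟩ := hA (Sum.elim 0 v)
  have hx : ∀ t, HasDerivAt (fun t i => X t (Sum.inl i))
      (S.mulVec (fun i => X t (Sum.inl i)) + Q.mulVec (fun i => X t (Sum.inr i))) t := by
    intro t
    rw [hasDerivAt_pi]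
    intro i
    have := hasDerivAt_pi.1 (hX t) (Sum.inl i)
    rw [Matrix.fromBlocks_mulVec] at this
    exact this
  have hz : ∀ t, HasDerivAt (fun t i => X t (Sum.inr i))
      (P.mulVec (fun i => X t (Sum.inr i))) t := by
    intro t
    rw [hasDerivAt_pi]
    intro i
    have := hasDerivAt_pi.1 (hX t) (Sum.inr i)
    rw [Matrix.fromBlocks_mulVec, Matrix.zero_mulVec, zero_add] at this
    exact this
  have hz0 : (fun i => X 0 (Sum.inr i)) = v := by simp [h0]
  have hzt : ∀ t, (fun i => X t (Sum.inr i)) = Complex.exp (μ * t) • v := by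
    intro t
    rw [← hz0]
    exact eq_exp_smul_of_hasDerivAt_mulVec hz (by simpa only [hz0] using hv) t
  let ℓc : (a → ℂ) →L[ℂ] ℂ := LinearMap.toContinuousLinearMap ℓ
  -- Variation of constants: the factor `exp (-μ t)` cancels the action of `S` under `ℓ` and also
  -- the growth of `z`, leaving the constant forcing `ℓ (Q v)`.
  have hf : ∀ t : ℝ, HasDerivAt (fun t : ℝ => Complex.exp (-μ * t) * ℓ (fun i => X t (Sum.inl i))
      - t * ℓ (Q.mulVec v)) 0 t := by
    intro t
    have h1 : HasDerivAt (fun s : ℝ => Complex.exp (-μ * s)) (Complex.exp (-μ * t) * -μ) t := by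
      have := ((Complex.ofRealCLM.hasDerivAt (x := t)).const_mul (-μ)).cexp
      simpa using this
    have h2 := (ℓc.restrictScalars ℝ).hasFDerivAt.comp_hasDerivAt t (hx t)
    have h3 := (Complex.ofRealCLM.hasDerivAt (x := t)).mul_const (ℓ (Q.mulVec v))
    refine ((h1.mul h2).sub h3).congr_deriv ?_
    have h4 : (ℓc.restrictScalars ℝ) (S.mulVec (fun i => X t (Sum.inl i))
        + Q.mulVec (fun i => X t (Sum.inr i)))
        = μ * ℓ (fun i => X t (Sum.inl i)) + Complex.exp (μ * t) * ℓ (Q.mulVec v) := by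
      change ℓ _ = _
      rw [map_add, hS, hzt, Matrix.mulVec_smul, map_smul, smul_eq_mul]
    have h5 : Complex.exp (-μ * t) * Complex.exp (μ * t) = 1 := by
      rw [← Complex.exp_add]; simp
    rw [h4]
    change Complex.exp (-μ * t) * -μ * ℓ (fun i => X t (Sum.inl i)) + Complex.exp (-μ * t) *
      (μ * ℓ (fun i => X t (Sum.inl i)) + Complex.exp (μ * t) * ℓ (Q.mulVec v))
      - Complex.ofRealCLM 1 * ℓ (Q.mulVec v) = 0
    rw [Complex.ofRealCLM_apply, Complex.ofReal_one]
    linear_combination ℓ (Q.mulVec v) * h5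
  have hconst : ∀ t : ℝ, Complex.exp (-μ * t) * ℓ (fun i => X t (Sum.inl i))
      = t * ℓ (Q.mulVec v) := by
    intro t
    have h := is_const_of_deriv_eq_zero (fun s => (hf s).differentiableAt)
      (fun s => (hf s).deriv) t 0
    have h00 : (fun i => X 0 (Sum.inl i)) = (0 : a → ℂ) := by ext i; simp [h0]
    simp only [h00, map_zero, mul_zero, Complex.ofReal_zero, zero_mul, sub_zero] at h
    exact sub_eq_zero.1 h
  have hbound : ∀ t > 0, t * ‖ℓ (Q.mulVec v)‖ ≤ ‖ℓc‖ * C := by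
    intro t ht
    have hC0 : 0 ≤ C := (norm_nonneg _).trans (hC t ht)
    have h1 : ‖ℓ (fun i => X t (Sum.inl i))‖ ≤ ‖ℓc‖ * C := by
      refine (ℓc.le_opNorm _).trans ?_
      gcongr
      exact (pi_norm_le_iff_of_nonneg hC0).2 fun i => (norm_le_pi_norm (X t) _).trans (hC t ht)
    -- Here `0 ≤ μ.re` enters: the factor does not spoil the bound on `ℓ(x)`, while the other side
    -- grows linearly in `t`.
    have h2 : ‖Complex.exp (-μ * t)‖ ≤ 1 := by
      rw [Complex.norm_exp, Real.exp_le_one_iff]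
      simp only [neg_mul, Complex.neg_re, Complex.mul_re, Complex.ofReal_re, Complex.ofReal_im,
        mul_zero, sub_zero, Left.neg_nonpos_iff]
      positivity
    have h3 := congrArg norm (hconst t)
    rw [norm_mul, norm_mul, Complex.norm_real, Real.norm_eq_abs, abs_of_pos ht] at h3
    rw [← h3]
    calc _ ≤ 1 * ‖ℓ (fun i => X t (Sum.inl i))‖ := by gcongr
      _ ≤ _ := by rw [one_mul]; exact h1
  have hlim : Filter.Tendsto (fun t : ℝ => t * ‖ℓ (Q.mulVec v)‖) Filter.atTop Filter.atTop :=
    Filter.tendsto_id.atTop_mul_const (norm_pos_iff.2 hℓ)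
  obtain ⟨t, ht, ht'⟩ :=
    ((Filter.eventually_gt_atTop (0 : ℝ)).and (hlim.eventually_gt_atTop (‖ℓc‖ * C))).exists
  exact absurd (hbound t ht) (not_le.2 ht')

/-! ### Hamiltonian matrices and coupled passings -/

/-- The spectrum of a Hamiltonian matrix is symmetric about the origin. -/
theorem charpoly_neg_J_mul_eq {l R : Type*} [Fintype l] [DecidableEq l] [CommRing R]
    {K : Matrix (l ⊕ l) (l ⊕ l) R} (hK : K.IsSymm) :
    (-(Matrix.J l R * K)).charpoly = (Matrix.J l R * K).charpoly := by
  -- The transpose of `-(J K)` is `K J`, as `K` is symmetric and `J` skew; and `K J`, `J K` share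
  -- their characteristic polynomial.
  rw [← Matrix.charpoly_transpose, Matrix.transpose_neg, Matrix.transpose_mul, hK.eq,
    Matrix.J_transpose, Matrix.mul_neg, neg_neg, Matrix.charpoly_mul_comm]

theorem not_coupledPassing_of_hasBoundedTrajectories {l b : Type*} [Fintype l] [DecidableEq l]
    [Fintype b] [DecidableEq b] {A : Matrix ((l ⊕ l) ⊕ b) ((l ⊕ l) ⊕ b) ℝ}
    {K : Matrix (l ⊕ l) (l ⊕ l) ℝ} (hK : K.IsSymm) (hS : A.toBlocks₁₁ = -(Matrix.J l ℝ * K))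
    (hA₂₁ : A.toBlocks₂₁ = 0) (hA : HasBoundedTrajectories (A.map Complex.ofReal)) :
    ¬ CoupledPassing A.toBlocks₁₁ A.toBlocks₁₂ A.toBlocks₂₂ := by
  rintro ⟨μ, v, hv, hμ, hempty⟩
  have hblocks : A.map Complex.ofReal = Matrix.fromBlocks (A.toBlocks₁₁.map Complex.ofReal)
      (A.toBlocks₁₂.map Complex.ofReal) 0 (A.toBlocks₂₂.map Complex.ofReal) := by
    conv_lhs => rw [← Matrix.fromBlocks_toBlocks A, hA₂₁, Matrix.fromBlocks_map]
    simp
  rw [hblocks] at hA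
  -- In the right half-plane the empty preimage is contradicted; in the left one only the eigenvalue
  -- `-μ` of `S` matters.
  rcases le_or_gt 0 μ.re with h | h
  · obtain ⟨w, hw⟩ := hA.exists_mulVec_eq (by simpa using hv.apply_eq_smul) h
    have : w ∈ (∅ : Set (l ⊕ l → ℂ)) := hempty ▸ hw
    exact this
  · set S := A.toBlocks₁₁.map Complex.ofReal with hSdef
    have hchar : S.charpoly = (-S).charpoly := by
      have hS' : S = -(Matrix.J l ℂ * K.map Complex.ofReal) := by
        have hJ : (Matrix.J l ℝ).map Complex.ofReal = Matrix.J l ℂ := by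
          ext i j
          rcases i with i | i <;> rcases j with j | j <;>
            simp [Matrix.J, Matrix.one_apply, apply_ite]
        rw [← hJ, hSdef, hS]
        have := (Matrix.map_mul (L := Matrix.J l ℝ) (M := K) (f := Complex.ofRealHom))
        change _ = -((Matrix.J l ℝ).map Complex.ofRealHom * K.map Complex.ofRealHom)
        rw [← this]
        ext i j
        exact Complex.ofReal_neg _
      rw [hS', neg_neg]
      exact charpoly_neg_J_mul_eq (hK.map _)
    have hneg : Module.End.HasEigenvalue (Matrix.toLin' (-S)) μ := by
      rw [Module.End.hasEigenvalue_iff_isRoot_charpoly, Matrix.charpoly_toLin'] at hμ ⊢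
      rwa [← hchar]
    obtain ⟨u, hu⟩ := hneg.exists_hasEigenvector
    have hu' : S.mulVec u = (-μ) • u := by
      have := hu.apply_eq_smul
      rw [Matrix.toLin'_apply, Matrix.neg_mulVec] at this
      rw [neg_smul, ← this, neg_neg]
    have := hA.re_nonpos (ν := -μ) (v := Sum.elim u 0) (fun h0 => hu.2 ?_) ?_
    · rw [Complex.neg_re] at this
      linarith
    · ext i
      exact congrFun h0 (Sum.inl i)
    · rw [Matrix.fromBlocks_mulVec]
      ext (i | i)
      · simp [hu']
      · simp


/-! ### The linearization at a zero does not depend on the chart -/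

section Linearization

variable {E : Type*} [NormedAddCommGroup E] [NormedSpace ℝ E]
  {M : Type*} [TopologicalSpace M] [ChartedSpace E M]
  {ι : Type*} [Fintype ι]

theorem mdifferentiable_of_contMDiffOn {φ : OpenPartialHomeomorph M (ι → ℝ)}
    (h₁ : ContMDiffOn 𝓘(ℝ, E) 𝓘(ℝ, ι → ℝ) ∞ φ φ.source)
    (h₂ : ContMDiffOn 𝓘(ℝ, ι → ℝ) 𝓘(ℝ, E) ∞ φ.symm φ.target) :
    φ.MDifferentiable 𝓘(ℝ, E) 𝓘(ℝ, ι → ℝ) :=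
  ⟨h₁.mdifferentiableOn (by simp), h₂.mdifferentiableOn (by simp)⟩

/-- The linearization of a vector field at a zero is conjugate, by the derivative of a chart `φ`,
to the derivative of the representative `Y` of the vector field in this chart. -/
theorem mfderiv_linearization_apply [IsManifold 𝓘(ℝ, E) ∞ M] {φ : OpenPartialHomeomorph M (ι → ℝ)}
    (h₁ : ContMDiffOn 𝓘(ℝ, E) 𝓘(ℝ, ι → ℝ) ∞ φ φ.source)
    (h₂ : ContMDiffOn 𝓘(ℝ, ι → ℝ) 𝓘(ℝ, E) ∞ φ.symm φ.target)
    {X : (w : M) → TangentSpace 𝓘(ℝ, E) w} {z₀ : M} (hz₀ : z₀ ∈ φ.source) (hX : X z₀ = 0)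
    {Y : (ι → ℝ) → (ι → ℝ)} (hY : DifferentiableAt ℝ Y (φ z₀))
    (hXY : ∀ᶠ w in 𝓝 z₀, mfderiv 𝓘(ℝ, E) 𝓘(ℝ, ι → ℝ) φ w (X w) = Y (φ w))
    (v : TangentSpace 𝓘(ℝ, E) z₀) :
    mfderiv 𝓘(ℝ, E) 𝓘(ℝ, ι → ℝ) φ z₀ (linearization X z₀ v)
      = fderiv ℝ Y (φ z₀) (mfderiv 𝓘(ℝ, E) 𝓘(ℝ, ι → ℝ) φ z₀ v) := by
  have : IsManifold 𝓘(ℝ, E) 1 M := IsManifold.of_le (n := ∞) (by simp)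
  have hφ := mdifferentiable_of_contMDiffOn h₁ h₂
  set c := extChartAt 𝓘(ℝ, E) z₀ with hc
  -- `g` is the transition map from `φ` to the preferred chart; its derivative turns `Y` into the
  -- field read in the trivialization.
  set g : (ι → ℝ) → E := fun y => c (φ.symm y) with hg
  have ht₀ : φ z₀ ∈ φ.target := φ.map_source hz₀
  have hgs : ContDiffAt ℝ ∞ g (φ z₀) := by
    have a1 : ContMDiffAt 𝓘(ℝ, ι → ℝ) 𝓘(ℝ, E) ∞ φ.symm (φ z₀) :=
      h₂.contMDiffAt (φ.open_target.mem_nhds ht₀)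
    have a2 : ContMDiffAt 𝓘(ℝ, E) 𝓘(ℝ, E) ∞ c (φ.symm (φ z₀)) := by
      rw [φ.left_inv hz₀]
      exact contMDiffAt_extChartAt
    exact (a2.comp (φ z₀) a1).contDiffAt
  have hfg : ∀ w ∈ φ.source, w ∈ (chartAt E z₀).source → ∀ u : ι → ℝ,
      fderiv ℝ g (φ w) u = mfderiv 𝓘(ℝ, E) 𝓘(ℝ, E) c w
        (mfderiv 𝓘(ℝ, ι → ℝ) 𝓘(ℝ, E) φ.symm (φ w) u) := by
    intro w hw hwc u
    have d1 := (hφ.mdifferentiableAt_symm (φ.map_source hw)).hasMFDerivAt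
    have d2 : HasMFDerivAt 𝓘(ℝ, E) 𝓘(ℝ, E) c (φ.symm (φ w))
        (mfderiv 𝓘(ℝ, E) 𝓘(ℝ, E) c w) := by
      rw [φ.left_inv hw]
      exact (mdifferentiableAt_extChartAt hwc).hasMFDerivAt
    have d3 : HasMFDerivAt 𝓘(ℝ, ι → ℝ) 𝓘(ℝ, E) g (φ w) _ := d2.comp (φ w) d1
    rw [← mfderiv_eq_fderiv, d3.mfderiv]
    rfl
  have hinv : ∀ w (hw : w ∈ φ.source) (u : TangentSpace 𝓘(ℝ, E) w),
      mfderiv 𝓘(ℝ, ι → ℝ) 𝓘(ℝ, E) φ.symm (φ w) (mfderiv 𝓘(ℝ, E) 𝓘(ℝ, ι → ℝ) φ w u) = u := by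
    intro w hw u
    exact DFunLike.congr_fun (hφ.symm_comp_deriv hw) u
  have hEq : (fun w => (trivializationAt E (TangentSpace 𝓘(ℝ, E)) z₀ ⟨w, X w⟩).2)
      =ᶠ[𝓝 z₀] fun w => fderiv ℝ g (φ w) (Y (φ w)) := by
    filter_upwards [hXY, φ.open_source.mem_nhds hz₀,
      (chartAt E z₀).open_source.mem_nhds (mem_chart_source E z₀)] with w h hw hwc
    rw [hfg w hw hwc, ← h]
    erw [hinv w hw]
    rw [hc, ← TangentBundle.continuousLinearMapAt_trivializationAt hwc]
    exact (congrFun ((trivializationAt E (TangentSpace 𝓘(ℝ, E)) z₀).coe_linearMapAt_of_mem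
      (R := ℝ) (b := w) hwc) (X w)).symm
  have hY0 : Y (φ z₀) = 0 := by
    rw [← hXY.self_of_nhds, hX]
    exact map_zero _
  -- The product rule also yields a term with the second derivative of `g` applied to `Y (φ z₀)`; it
  -- drops out because the field vanishes at `z₀`.
  have hG : HasFDerivAt (fun y => fderiv ℝ g y (Y y))
      ((fderiv ℝ g (φ z₀)).comp (fderiv ℝ Y (φ z₀))) (φ z₀) := by
    have e1 : DifferentiableAt ℝ (fderiv ℝ g) (φ z₀) :=
      (hgs.fderiv_right (m := ∞) (by simp)).differentiableAt (by simp)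
    refine (e1.hasFDerivAt.clm_apply hY.hasFDerivAt).congr_fderiv ?_
    rw [hY0, map_zero, add_zero]
  have hL : HasMFDerivAt 𝓘(ℝ, E) 𝓘(ℝ, E) (fun w => fderiv ℝ g (φ w) (Y (φ w))) z₀ _ :=
    hG.hasMFDerivAt.comp z₀ (hφ.mdifferentiableAt hz₀).hasMFDerivAt
  have hLv : linearization X z₀ v
      = fderiv ℝ g (φ z₀) (fderiv ℝ Y (φ z₀) (mfderiv 𝓘(ℝ, E) 𝓘(ℝ, ι → ℝ) φ z₀ v)) := by
    unfold linearization
    rw [hEq.mfderiv_eq, hL.mfderiv]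
    rfl
  rw [hLv, hfg z₀ hz₀ (mem_chart_source E z₀), hc, mfderiv_extChartAt_self]
  obtain ⟨u, hu⟩ := hφ.mfderiv_surjective hz₀
    (fderiv ℝ Y (φ z₀) (mfderiv 𝓘(ℝ, E) 𝓘(ℝ, ι → ℝ) φ z₀ v))
  rw [← hu, hinv z₀ hz₀]
  rfl

end Linearization

/-! ### Locality of the Poisson bracket and its coordinate expression -/

section Bracket

variable {E : Type*} [NormedAddCommGroup E] [NormedSpace ℝ E] [FiniteDimensional ℝ E]
  {M : Type*} [TopologicalSpace M] [T2Space M] [ChartedSpace E M] [IsManifold 𝓘(ℝ, E) ∞ M]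
  (B : PoissonStructure E M) {ι : Type*} [Fintype ι]

/-- Bracketing with `G` is differentiation along its Hamiltonian vector field, which sees only
germs. -/
theorem PoissonStructure.bracket_congr_left {F F' : C^∞⟮𝓘(ℝ, E), M; ℝ⟯}
    (G : C^∞⟮𝓘(ℝ, E), M; ℝ⟯) {w : M} (h : F =ᶠ[𝓝 w] F') :
    B.bracket F G w = B.bracket F' G w := by
  rw [← B.mfderiv_hamiltonianVectorField, ← B.mfderiv_hamiltonianVectorField, h.mfderiv_eq]
  rfl

omit [FiniteDimensional ℝ E] [T2Space M] [IsManifold 𝓘(ℝ, E) ∞ M] in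
theorem PoissonStructure.bracket_apply_skew (F G : C^∞⟮𝓘(ℝ, E), M; ℝ⟯) (w : M) :
    B.bracket F G w = -B.bracket G F w := by
  rw [B.skew F G]
  rfl

/-- Makes local brackets independent of the extensions: locality in the first entry carries over to
the second by skew-symmetry. -/
theorem PoissonStructure.HasLocalBracket.bracket_eq {B : PoissonStructure E M} {f g : M → ℝ}
    {w : M} {c : ℝ} (h : B.HasLocalBracket f g w c) {F G : C^∞⟮𝓘(ℝ, E), M; ℝ⟯}
    (hF : F =ᶠ[𝓝 w] f) (hG : G =ᶠ[𝓝 w] g) : B.bracket F G w = c := by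
  obtain ⟨F', G', hF', hG', rfl⟩ := h
  rw [B.bracket_congr_left G (hF.trans hF'.symm), B.bracket_apply_skew,
    B.bracket_congr_left F' (hG.trans hG'.symm), ← B.bracket_apply_skew]

omit [FiniteDimensional ℝ E] [T2Space M] [IsManifold 𝓘(ℝ, E) ∞ M] in
theorem mfderiv_apply_eq_of_eventuallyEq {f : M → ι → ℝ} {w : M}
    (hf : MDifferentiableAt 𝓘(ℝ, E) 𝓘(ℝ, ι → ℝ) f w) {i : ι} {F : M → ℝ}
    (hF : F =ᶠ[𝓝 w] fun y => f y i) (v : TangentSpace 𝓘(ℝ, E) w) :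
    (mfderiv 𝓘(ℝ, E) 𝓘(ℝ, ι → ℝ) f w v : ι → ℝ) i = mfderiv 𝓘(ℝ, E) 𝓘(ℝ, ℝ) F w v := by
  have h : HasMFDerivAt 𝓘(ℝ, E) 𝓘(ℝ, ℝ) (fun y => f y i) w _ :=
    ((ContinuousLinearMap.proj (R := ℝ) (φ := fun _ : ι => ℝ) i).hasFDerivAt
      (x := f w)).hasMFDerivAt.comp w hf.hasMFDerivAt
  rw [hF.mfderiv_eq, h.mfderiv]
  rfl

/-- The bracket with `H` in terms of the brackets with the coordinate functions. -/
theorem PoissonStructure.bracket_eq_sum [DecidableEq ι] {φ : OpenPartialHomeomorph M (ι → ℝ)}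
    (hφ : φ.MDifferentiable 𝓘(ℝ, E) 𝓘(ℝ, ι → ℝ)) {w : M} (hw : w ∈ φ.source)
    {F : ι → C^∞⟮𝓘(ℝ, E), M; ℝ⟯} (hF : ∀ j, F j =ᶠ[𝓝 w] fun y => φ y j)
    (G H : C^∞⟮𝓘(ℝ, E), M; ℝ⟯) :
    B.bracket G H w = ∑ j, B.bracket G (F j) w *
      fderiv ℝ (fun y => H (φ.symm y)) (φ w) (Pi.single j 1) := by
  set u := B.hamiltonianVectorField G w with hu
  have h1 : HasMFDerivAt 𝓘(ℝ, ι → ℝ) 𝓘(ℝ, ℝ) (fun y => H (φ.symm y)) (φ w) _ :=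
    (H.contMDiff.mdifferentiable (by simp) _).hasMFDerivAt.comp (φ w)
      (hφ.mdifferentiableAt_symm (φ.map_source hw)).hasMFDerivAt
  have h2 : DifferentiableAt ℝ (fun y => H (φ.symm y)) (φ w) :=
    h1.mdifferentiableAt.differentiableAt
  have h3 : HasMFDerivAt 𝓘(ℝ, E) 𝓘(ℝ, ℝ) (fun y => H (φ.symm (φ y))) w _ :=
    h2.hasFDerivAt.hasMFDerivAt.comp w (hφ.mdifferentiableAt hw).hasMFDerivAt
  have h4 : H =ᶠ[𝓝 w] fun y => H (φ.symm (φ y)) := by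
    filter_upwards [φ.open_source.mem_nhds hw] with y hy
    rw [φ.left_inv hy]
  have h5 : mfderiv 𝓘(ℝ, E) 𝓘(ℝ, ℝ) H w u = fderiv ℝ (fun y => H (φ.symm y)) (φ w)
      (mfderiv 𝓘(ℝ, E) 𝓘(ℝ, ι → ℝ) φ w u : ι → ℝ) := by
    rw [h4.mfderiv_eq, h3.mfderiv]
    rfl
  -- Skew-symmetry moves `H` into the differentiated entry: the bracket is `-dH(u)`, with `u` the
  -- Hamiltonian vector of `G`, and the chain rule expands `dH(u)` in the coordinates of `u`.
  rw [B.bracket_apply_skew, ← B.mfderiv_hamiltonianVectorField, ← hu, h5]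
  have h6 := (fderiv ℝ (fun y => H (φ.symm y)) (φ w)).toLinearMap.pi_apply_eq_sum_univ
    (mfderiv 𝓘(ℝ, E) 𝓘(ℝ, ι → ℝ) φ w u : ι → ℝ)
  refine (congrArg Neg.neg h6).trans ?_
  rw [← Finset.sum_neg_distrib]
  refine Finset.sum_congr rfl fun j _ => ?_
  rw [mfderiv_apply_eq_of_eventuallyEq (hφ.mdifferentiableAt hw) (hF j), hu,
    B.mfderiv_hamiltonianVectorField, B.bracket_apply_skew, smul_eq_mul, neg_mul, neg_neg]
  refine congrArg (B.bracket G (F j) w * ·) (congrArg _ (funext fun k => ?_))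
  simp [Pi.single_apply, eq_comm]

end Bracket

/-! ### Block structure in a Darboux-Weinstein chart -/

section DarbouxWeinstein

variable {E : Type*} [NormedAddCommGroup E] [NormedSpace ℝ E] [FiniteDimensional ℝ E]
  {M : Type*} [TopologicalSpace M] [T2Space M] [ChartedSpace E M] [IsManifold 𝓘(ℝ, E) ∞ M]
  {B : PoissonStructure E M} {n r : ℕ} {φ : OpenPartialHomeomorph M (DWIndex n r → ℝ)} {z₀ : M}

omit [FiniteDimensional ℝ E] [T2Space M] [IsManifold 𝓘(ℝ, E) ∞ M] in
/-- The coordinate functions extend to global smooth functions near the base point. -/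
theorem PoissonStructure.IsDarbouxWeinsteinChart.exists_extension
    (hφ : B.IsDarbouxWeinsteinChart φ z₀) :
    ∃ F : DWIndex n r → C^∞⟮𝓘(ℝ, E), M; ℝ⟯, ∀ i, F i =ᶠ[𝓝 z₀] fun y => φ y i := by
  suffices h : ∀ i, ∃ F : C^∞⟮𝓘(ℝ, E), M; ℝ⟯, F =ᶠ[𝓝 z₀] fun y => φ y i from
    ⟨fun i => (h i).choose, fun i => (h i).choose_spec⟩
  intro i
  rcases i with (i | i) | k
  -- Each bracket hypothesis already carries global extensions; pairing a coordinate with itself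
  -- yields one for it.
  · obtain ⟨F, -, hF, -⟩ := hφ.bracket_qq z₀ hφ.mem_source i i
    exact ⟨F, hF⟩
  · obtain ⟨F, -, hF, -⟩ := hφ.bracket_pp z₀ hφ.mem_source i i
    exact ⟨F, hF⟩
  · obtain ⟨R, -, h⟩ := hφ.bracket_zz
    obtain ⟨F, -, hF, -⟩ := h z₀ hφ.mem_source k k
    exact ⟨F, hF⟩

/-- The minus sign arises because `Matrix.J` has `-1` in its upper right block, where `{q, p}` is
`+1`. -/
theorem PoissonStructure.IsDarbouxWeinsteinChart.bracket_inl_inl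
    (hφ : B.IsDarbouxWeinsteinChart φ z₀) {F : DWIndex n r → C^∞⟮𝓘(ℝ, E), M; ℝ⟯} {w : M}
    (hw : w ∈ φ.source) (hF : ∀ j, F j =ᶠ[𝓝 w] fun y => φ y j) (i j : Fin n ⊕ Fin n) :
    B.bracket (F (.inl i)) (F (.inl j)) w = -Matrix.J (Fin n) ℝ i j := by
  rcases i with i | i <;> rcases j with j | j
  · simpa [Matrix.J] using (hφ.bracket_qq w hw i j).bracket_eq (hF _) (hF _)
  · simpa [Matrix.J, Matrix.one_apply] using (hφ.bracket_qp w hw i j).bracket_eq (hF _) (hF _)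
  · rw [B.bracket_apply_skew, (hφ.bracket_qp w hw j i).bracket_eq (hF _) (hF _)]
    simp [Matrix.J, Matrix.one_apply, eq_comm]
  · simpa [Matrix.J] using (hφ.bracket_pp w hw i j).bracket_eq (hF _) (hF _)

theorem PoissonStructure.IsDarbouxWeinsteinChart.bracket_inl_inr
    (hφ : B.IsDarbouxWeinsteinChart φ z₀) {F : DWIndex n r → C^∞⟮𝓘(ℝ, E), M; ℝ⟯} {w : M}
    (hw : w ∈ φ.source) (hF : ∀ j, F j =ᶠ[𝓝 w] fun y => φ y j) (i : Fin n ⊕ Fin n) (k : Fin r) :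
    B.bracket (F (.inl i)) (F (.inr k)) w = 0 := by
  rcases i with i | i
  · exact (hφ.bracket_qz w hw i k).bracket_eq (hF _) (hF _)
  · exact (hφ.bracket_pz w hw i k).bracket_eq (hF _) (hF _)

/-- In a Darboux-Weinstein chart the linearization of a Hamiltonian vector field at an equilibrium
is block triangular, and its first diagonal block is a Hamiltonian matrix. -/
theorem PoissonStructure.IsDarbouxWeinsteinChart.linearization_blocks
    (hφ : B.IsDarbouxWeinsteinChart φ z₀) {H : C^∞⟮𝓘(ℝ, E), M; ℝ⟯}
    (hH : B.hamiltonianVectorField H z₀ = 0) :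
    ∃ A : Matrix (DWIndex n r) (DWIndex n r) ℝ, ∃ K : Matrix (Fin n ⊕ Fin n) (Fin n ⊕ Fin n) ℝ,
      K.IsSymm ∧ A.toBlocks₁₁ = -(Matrix.J (Fin n) ℝ * K) ∧ A.toBlocks₂₁ = 0 ∧
      ∀ v, (mfderiv 𝓘(ℝ, E) 𝓘(ℝ, DWIndex n r → ℝ) φ z₀
          (linearization (B.hamiltonianVectorField H) z₀ v) : DWIndex n r → ℝ)
        = A.mulVec (mfderiv 𝓘(ℝ, E) 𝓘(ℝ, DWIndex n r → ℝ) φ z₀ v : DWIndex n r → ℝ) := by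
  have hd := mdifferentiable_of_contMDiffOn hφ.contMDiffOn hφ.contMDiffOn_symm
  have hz₀ := hφ.mem_source
  have ht₀ : φ z₀ ∈ φ.target := φ.map_source hz₀
  obtain ⟨F, hF⟩ := hφ.exists_extension
  -- One family of extensions, chosen at `z₀`, serves at all nearby points, so brackets can be
  -- differentiated at `z₀`.
  have hN : ∀ᶠ w in 𝓝 z₀, w ∈ φ.source ∧ ∀ j, F j =ᶠ[𝓝 w] fun y => φ y j :=
    Filter.Eventually.and (φ.open_source.mem_nhds hz₀)
      (Filter.eventually_all.2 fun j => (hF j).eventuallyEq_nhds)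
  have hN' : ∀ᶠ y in 𝓝 (φ z₀), y ∈ φ.target ∧ ∀ j, F j =ᶠ[𝓝 (φ.symm y)] fun y => φ y j := by
    have := (φ.continuousAt_symm ht₀).eventually (by rw [φ.left_inv hz₀]; exact hN)
    filter_upwards [this, φ.open_target.mem_nhds ht₀] with y hy hyt
    exact ⟨hyt, hy.2⟩
  have hsymm : ∀ G : C^∞⟮𝓘(ℝ, E), M; ℝ⟯, ContDiffAt ℝ ∞ (fun y => G (φ.symm y)) (φ z₀) := by
    intro G
    exact ((G.contMDiff _).comp (φ z₀)
      (hφ.contMDiffOn_symm.contMDiffAt (φ.open_target.mem_nhds ht₀))).contDiffAt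
  set Y : (DWIndex n r → ℝ) → (DWIndex n r → ℝ) := fun y i =>
    B.bracket (F i) H (φ.symm y) with hYdef
  have hYi : ∀ i, DifferentiableAt ℝ (fun y => Y y i) (φ z₀) := fun i =>
    (hsymm (B.bracket (F i) H)).differentiableAt (by simp)
  have hY : DifferentiableAt ℝ Y (φ z₀) := differentiableAt_pi.2 hYi
  have hXY : ∀ᶠ w in 𝓝 z₀, mfderiv 𝓘(ℝ, E) 𝓘(ℝ, DWIndex n r → ℝ) φ w
      (B.hamiltonianVectorField H w) = Y (φ w) := by
    filter_upwards [hN] with w hw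
    funext i
    refine (mfderiv_apply_eq_of_eventuallyEq (hd.mdifferentiableAt hw.1) (hw.2 i) _).trans ?_
    rw [B.mfderiv_hamiltonianVectorField, hYdef]
    simp only [φ.left_inv hw.1]
  set h : (DWIndex n r → ℝ) → ℝ := fun y => H (φ.symm y)
  have hYsum : ∀ᶠ y in 𝓝 (φ z₀), ∀ i, Y y i = ∑ j, B.bracket (F i) (F j) (φ.symm y) *
      fderiv ℝ h y (Pi.single j 1) := by
    filter_upwards [hN'] with y hy i
    have := B.bracket_eq_sum hd (φ.map_target hy.1) hy.2 (F i) H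
    rw [φ.right_inv hy.1] at this
    exact this
  have hentry : ∀ i k, LinearMap.toMatrix' (fderiv ℝ Y (φ z₀)).toLinearMap i k
      = fderiv ℝ (fun y => Y y i) (φ z₀) (Pi.single k 1) := by
    intro i k
    rw [LinearMap.toMatrix'_apply, fderiv_apply hY i]
    simp only [ContinuousLinearMap.coe_coe, ContinuousLinearMap.comp_apply,
      ContinuousLinearMap.proj_apply]
  have hh2 : ContDiffAt ℝ ∞ h (φ z₀) := hsymm H
  have hfd : DifferentiableAt ℝ (fderiv ℝ h) (φ z₀) :=
    (hh2.fderiv_right (m := ∞) (by simp)).differentiableAt (by simp)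
  have hsec := hh2.isSymmSndFDerivAt (by simp [show (2 : WithTop ℕ∞) ≤ ∞ from WithTop.coe_le_coe.2 le_top])
  refine ⟨LinearMap.toMatrix' (fderiv ℝ Y (φ z₀)).toLinearMap,
    Matrix.of fun i j => fderiv ℝ (fderiv ℝ h) (φ z₀) (Pi.single (.inl i) 1)
      (Pi.single (.inl j) 1), ?_, ?_, ?_, fun v => ?_⟩
  · ext i j
    exact hsec _ _
  · ext i k
    change LinearMap.toMatrix' (fderiv ℝ Y (φ z₀)).toLinearMap (.inl i) (.inl k) = _
    rw [hentry]
    -- Hamilton's equations: the `x` components have the constant coefficients `-J`, and the `z`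
    -- derivatives of `h` do not enter. Differentiation then gives `-J` times the Hessian.
    have hloc : (fun y => Y y (.inl i)) =ᶠ[𝓝 (φ z₀)] fun y => ∑ j, -Matrix.J (Fin n) ℝ i j *
        fderiv ℝ h y (Pi.single (.inl j) 1) := by
      filter_upwards [hYsum, hN'] with y hy hyN
      rw [hy, Fintype.sum_sum_type]
      simp only [hφ.bracket_inl_inl (φ.map_target hyN.1) hyN.2,
        hφ.bracket_inl_inr (φ.map_target hyN.1) hyN.2, zero_mul, Finset.sum_const_zero, add_zero]
    have hder : HasFDerivAt (fun y => ∑ j, -Matrix.J (Fin n) ℝ i j *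
        fderiv ℝ h y (Pi.single (.inl j) 1)) (∑ j, -Matrix.J (Fin n) ℝ i j •
        (fderiv ℝ (fderiv ℝ h) (φ z₀)).flip (Pi.single (.inl j) 1)) (φ z₀) := by
      refine HasFDerivAt.fun_sum fun j _ => ?_
      refine HasFDerivAt.const_mul ?_ _
      refine (hfd.hasFDerivAt.clm_apply (hasFDerivAt_const _ _)).congr_fderiv ?_
      ext; simp
    rw [hloc.fderiv_eq, hder.fderiv, Matrix.neg_apply, Matrix.mul_apply, ← Finset.sum_neg_distrib,
      sum_apply]
    refine Finset.sum_congr rfl fun j _ => ?_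
    simp only [smul_apply, ContinuousLinearMap.flip_apply, smul_eq_mul,
      Matrix.of_apply, neg_mul]
    rw [hsec]
  · ext k i
    change LinearMap.toMatrix' (fderiv ℝ Y (φ z₀)).toLinearMap (.inr k) (.inl i) = 0
    rw [hentry]
    obtain ⟨R, hR0, hR⟩ := hφ.bracket_zz
    have hline : Filter.Tendsto (fun t : ℝ => φ z₀ + t • (Pi.single (.inl i) 1 : DWIndex n r → ℝ))
        (𝓝 0) (𝓝 (φ z₀)) := by
      have : Continuous fun t : ℝ => φ z₀ + t • (Pi.single (.inl i) 1 : DWIndex n r → ℝ) := by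
        fun_prop
      simpa using this.tendsto 0
    -- Moving along an `x` axis keeps `z = 0`, where `R` vanishes, so the `z` component is
    -- identically zero on this line. Arguing on the line avoids differentiating `R`, which carries
    -- no regularity.
    have hzero : (fun t : ℝ => Y (φ z₀ + t • Pi.single (.inl i) 1) (.inr k)) =ᶠ[𝓝 0]
        fun _ => 0 := by
      filter_upwards [hline.eventually hYsum, hline.eventually hN'] with t ht htN
      have hw := φ.map_target htN.1
      have hR' : R (fun m => φ (φ.symm (φ z₀ + t • Pi.single (.inl i) 1)) (.inr m)) = 0 := by
        rw [φ.right_inv htN.1, hφ.map_point, ← hR0]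
        congr 1
        ext m
        simp
      rw [ht, Fintype.sum_sum_type]
      have e1 : ∀ j, B.bracket (F (.inr k)) (F (.inl j))
          (φ.symm (φ z₀ + t • Pi.single (.inl i) 1)) = 0 := fun j => by
        rw [B.bracket_apply_skew, hφ.bracket_inl_inr hw htN.2, neg_zero]
      have e2 : ∀ l, B.bracket (F (.inr k)) (F (.inr l))
          (φ.symm (φ z₀ + t • Pi.single (.inl i) 1)) = 0 := fun l => by
        rw [(hR _ hw k l).bracket_eq (htN.2 _) (htN.2 _), hR']
        rfl
      simp only [e1, e2, zero_mul, Finset.sum_const_zero, add_zero]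
    have hcurve : HasDerivAt (fun t : ℝ => Y (φ z₀ + t • Pi.single (.inl i) 1) (.inr k))
        (fderiv ℝ (fun y => Y y (.inr k)) (φ z₀) (Pi.single (.inl i) 1)) 0 := by
      have hl : HasDerivAt (fun t : ℝ => φ z₀ + t • (Pi.single (.inl i) 1 : DWIndex n r → ℝ))
          (Pi.single (.inl i) 1) 0 := by
        simpa using ((hasDerivAt_id (0 : ℝ)).smul_const
          (Pi.single (.inl i) 1 : DWIndex n r → ℝ)).const_add (φ z₀)
      refine HasFDerivAt.comp_hasDerivAt (l := fun y => Y y (.inr k)) 0 ?_ hl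
      simpa using (hYi (.inr k)).hasFDerivAt
    exact hcurve.unique ((hasDerivAt_const (0 : ℝ) (0 : ℝ)).congr_of_eventuallyEq hzero)
  · refine (mfderiv_linearization_apply hφ.contMDiffOn hφ.contMDiffOn_symm hz₀ hH hY hXY v).trans ?_
    exact (LinearMap.toMatrix'_mulVec (fderiv ℝ Y (φ z₀)).toLinearMap _).symm

end DarbouxWeinstein
end PoissonDynamics

/-! ### Conclusion -/

open PoissonDynamics
theorem proposition2p3 {E : Type*} [NormedAddCommGroup E] [NormedSpace ℝ E]
    [FiniteDimensional ℝ E] {M : Type*} [TopologicalSpace M] [T2Space M] [ChartedSpace E M]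
    [IsManifold 𝓘(ℝ, E) ∞ M] (B : PoissonStructure E M) (H : C^∞⟮𝓘(ℝ, E), M; ℝ⟯) (z_e : M)
    (h_eq : B.hamiltonianVectorField H z_e = 0)
    {n r : ℕ} (φ : OpenPartialHomeomorph M (DWIndex n r → ℝ))
    (hφ : B.IsDarbouxWeinsteinChart φ z_e)
    (h_passing : ExhibitsCoupledPassing (B.hamiltonianVectorField H) z_e φ) :
    IsLinearlyUnstable (B.hamiltonianVectorField H) z_e := by
  intro hstable
  have hd := mdifferentiable_of_contMDiffOn hφ.contMDiffOn hφ.contMDiffOn_symm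
  obtain ⟨A, K, hK, hS, hA₂₁, hA⟩ := hφ.linearization_blocks h_eq
  -- The tangent space is definitionally `E`. Stating `e` and `L` over `E` supplies the norm used by
  -- the boundedness lemmas.
  let e : E ≃L[ℝ] (DWIndex n r → ℝ) := hd.mfderiv hφ.mem_source
  let L : E →L[ℝ] E := linearization (B.hamiltonianVectorField H) z_e
  have hAe : ∀ v : E, e (L v) = A.mulVec (e v) := hA
  have hmat : matrixInChart φ z_e (linearization (B.hamiltonianVectorField H) z_e) = A := by
    change LinearMap.toMatrix' ((e : E →L[ℝ] (DWIndex n r → ℝ)) ∘L L ∘L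
      ((e : E →L[ℝ] (DWIndex n r → ℝ)).inverse)).toLinearMap = A
    rw [ContinuousLinearMap.inverse_equiv]
    conv_rhs => rw [← LinearMap.toMatrix'_toLin' A]
    congr 1
    refine LinearMap.ext fun y => ?_
    change e (L (e.symm y)) = A.mulVec y
    rw [hAe, e.apply_symm_apply]
  have hstable' : IsStableLinearSystem L := hstable
  have hbounded := hstable'.hasBoundedTrajectories (e : E →L[ℝ] (DWIndex n r → ℝ)) e.symm
    e.apply_symm_apply hAe
  unfold ExhibitsCoupledPassing at h_passing
  rw [hmat] at h_passing
  exact not_coupledPassing_of_hasBoundedTrajectories hK hS hA₂₁ hbounded h_passing
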